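/- For integers $k\ge 1$ and $n\ge 0$ let $p_{-k}(n)$ denote the number of $k$-colored partitions of $n$, that is, of partitions of $n$ in which each part may appear in any of $k$ colors; equivalently, $\sum_{n\ge 0}p_{-k}(n)q^n=\prod_{m\ge 1}(1-q^m)^{-k}$. Then for all integers $n\ge 0$ and $\alpha\ge 1$, \begin{align*} p_{-7}\left(5^{2\alpha-1}n+\frac{13\cdot 5^{2\alpha-1}+7}{24}\right)&\equiv 0\pmod{5^{\alpha}},\\ p_{-7}\left(5^{2\alpha}n+\frac{17\cdot 5^{2\alpha}+7}{24}\right)&\equiv 0\pmod{5^{\alpha+1}},\\ p_{-7}\left(5^{2\alpha}n+\frac{61\cdot 5^{2\alpha-1}+7}{24}\right)&\equiv 0\pmod{5^{\alpha+1}},\\ p_{-7}\left(5^{2\alpha}n+\frac{109\cdot 5^{2\alpha-1}+7}{24}\right)&\equiv 0\pmod{5^{\alpha+1}}. \end{align*} -/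

import Mathlib

/-- A partition of `n` in which each part carries one of `k` colors: a finite multiset of colored
positive integers (pairs `(part, color)`) whose parts sum to `n`. As for ordinary partitions, the
order of the colored parts is irrelevant and repetitions are allowed. -/
structure ColoredPartition (k n : ℕ) where
  parts : Multiset (ℕ × Fin k)
  parts_pos : ∀ x ∈ parts, 0 < x.1
  parts_sum : (parts.map Prod.fst).sum = n

/-- There are only finitely many `k`-colored partitions of `n`, so that `Nat.card` below is the
true count. -/
theorem ColoredPartition.finite (k n : ℕ) : Finite (ColoredPartition k n) := by
  classical
  let B : Multiset (ℕ × Fin k) := n • (Finset.range (n + 1) ×ˢ Finset.univ).val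
  have hle : ∀ c : ColoredPartition k n, c.parts ≤ B := by
    intro c
    have hmem : ∀ x ∈ c.parts, x.1 ≤ n := fun x hx => by
      rw [← c.parts_sum]
      exact Multiset.le_sum_of_mem (Multiset.mem_map_of_mem Prod.fst hx)
    have hcard : c.parts.card ≤ n := by
      have h := Multiset.card_nsmul_le_sum (s := c.parts.map Prod.fst) (a := 1) (by
        intro y hy
        obtain ⟨x, hx, rfl⟩ := Multiset.mem_map.1 hy
        exact c.parts_pos x hx)
      rw [c.parts_sum] at h
      simpa using h
    rw [Multiset.le_iff_count]
    intro x
    by_cases hx : x ∈ c.parts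
    · have h1 : x ∈ (Finset.range (n + 1) ×ˢ (Finset.univ : Finset (Fin k))) := by
        have := hmem x hx
        simp
        omega
      have h2 : 1 ≤ (Finset.range (n + 1) ×ˢ (Finset.univ : Finset (Fin k))).val.count x :=
        Multiset.one_le_count_iff_mem.2 h1
      calc c.parts.count x ≤ c.parts.card := Multiset.count_le_card _ _
        _ ≤ n := hcard
        _ ≤ n * (Finset.range (n + 1) ×ˢ (Finset.univ : Finset (Fin k))).val.count x :=
          Nat.le_mul_of_pos_right _ h2
        _ = B.count x := by simp only [B, Multiset.count_nsmul]
    · rw [Multiset.count_eq_zero_of_notMem hx]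
      exact Nat.zero_le _
  refine Finite.of_injective
    (fun c : ColoredPartition k n =>
      (⟨c.parts, by simpa using hle c⟩ : {s // s ∈ B.powerset.toFinset})) ?_
  rintro ⟨s, _, _⟩ ⟨t, _, _⟩ h
  simpa using h

/-- The number `p_{-k}(n)` of `k`-colored partitions of `n`. -/
noncomputable def coloredPartitionCount (k n : ℕ) : ℕ := Nat.card (ColoredPartition k n)

/-- All the quotients by `24` in the arguments of `p_{-7}` are exact. -/
theorem twentyFour_dvd (α : ℕ) (hα : 1 ≤ α) :
    24 ∣ 13 * 5 ^ (2 * α - 1) + 7 ∧ 24 ∣ 17 * 5 ^ (2 * α) + 7 ∧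
      24 ∣ 61 * 5 ^ (2 * α - 1) + 7 ∧ 24 ∣ 109 * 5 ^ (2 * α - 1) + 7 := by
  obtain ⟨b, rfl⟩ : ∃ b, α = b + 1 := ⟨α - 1, by omega⟩
  have h1 : 5 ^ (2 * (b + 1) - 1) = 5 * 25 ^ b := by
    rw [show 2 * (b + 1) - 1 = 2 * b + 1 by omega, pow_succ, pow_mul]; norm_num [mul_comm]
  have h2 : 5 ^ (2 * (b + 1)) = 25 * 25 ^ b := by
    rw [pow_mul, pow_succ]; norm_num [mul_comm]
  have h3 : 25 ^ b % 24 = 1 := by rw [Nat.pow_mod]; simp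
  rw [h1, h2]
  omega

/-! Write E for Euler's product, P = 1/E, and U for the operator keeping the exponents divisible by
5 and replacing q^5 by q. Put ζ = q E(q^25)/E(q) and τ = q E(q^5)^6/E(q)^6. This is the
Ramanujan–Watson method. The modular equation ζ^5 = τ(q^5)(1 + 5ζ + 15ζ^2 + 25ζ^3 + 25ζ^4) gives a
recurrence for U(ζ^i), so each U(ζ^i) is a polynomial in τ whose order and 5-adic valuations are
controlled by induction.

Since ζ^6 = τ(q) τ(q^5), the action of U on powers of τ, with or without the twist by q^7 P^7, is
read off from U(ζ^(6i)) and U(ζ^(6i+7)). After normalization by powers of q and E, the generating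
series along 5^(2α-1) and 5^(2α) are therefore polynomials in τ, obtained by alternating the two
operators, and each round gains a factor 5 (`OddDivisible`, `EvenDivisible`). This yields the first
two congruences.

For the last two, only the τ^2 term of the odd-stage polynomial survives modulo 5^(α+1). Its
contribution is a multiple of E(q^5)^5 P^12, congruent to E^3 E(q^5)^2 modulo 5, and E^3 has no
exponents congruent to 2 or 4 modulo 5.

The modular equation itself comes from E = A(q^5) - q E(q^25) + q^2 B(q^5) with AB = -E(q^5)^2,
together with the norm of E over fifth roots of unity. -/

open PowerSeries

/-! ### Sections of a power series modulo 5 -/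

/-- Euler's product `∏ (1 - X ^ m)`. -/
noncomputable abbrev eulerSeries : ℤ⟦X⟧ := pentagonalSeries ℤ

/-- The substitution `X ↦ X ^ 5`. -/
noncomputable abbrev expandFive : ℤ⟦X⟧ →ₐ[ℤ] ℤ⟦X⟧ := expand 5 (by norm_num)

/-- The series whose `n`-th coefficient is the coefficient of index `5 * n + r`. -/
noncomputable def quinsect (r : ℕ) : ℤ⟦X⟧ →+ ℤ⟦X⟧ where
  toFun f := PowerSeries.mk fun n => coeff (5 * n + r) f
  map_zero' := by ext; simp
  map_add' f g := by ext; simp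

@[simp]
theorem coeff_quinsect (r n : ℕ) (f : ℤ⟦X⟧) :
    coeff n (quinsect r f) = coeff (5 * n + r) f := by
  simp [quinsect]

theorem coeff_X_pow_mul_expandFive (j n : ℕ) (f : ℤ⟦X⟧) :
    coeff n (X ^ j * expandFive f) =
      if j ≤ n ∧ 5 ∣ n - j then coeff ((n - j) / 5) f else 0 := by
  rw [coeff_X_pow_mul']
  split_ifs with h1 h2 h2
  · rw [coeff_expand, if_pos h2.2]
  · rw [coeff_expand, if_neg (fun h => h2 ⟨h1, h⟩)]
  · exact absurd h2.1 h1
  · rfl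

theorem quinsect_X_pow_mul_expandFive {r : ℕ} (a : ℕ) (f : ℤ⟦X⟧) :
    quinsect r (X ^ (5 * a + r) * expandFive f) = X ^ a * f := by
  ext n
  rw [coeff_quinsect, coeff_X_pow_mul_expandFive, coeff_X_pow_mul']
  by_cases h : a ≤ n
  · rw [if_pos h, if_pos (by omega), show (5 * n + r - (5 * a + r)) / 5 = n - a by omega]
  · rw [if_neg h, if_neg (by omega)]

theorem quinsect_X_pow_mul_expandFive_of_ne {r j : ℕ} (h : j % 5 ≠ r % 5) (f : ℤ⟦X⟧) :
    quinsect r (X ^ j * expandFive f) = 0 := by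
  ext n
  rw [coeff_quinsect, coeff_X_pow_mul_expandFive, if_neg (by omega), map_zero]

theorem sum_X_pow_mul_expandFive_quinsect (f : ℤ⟦X⟧) :
    f = ∑ j ∈ Finset.range 5, X ^ j * expandFive (quinsect j f) := by
  ext n
  rw [map_sum]
  simp only [coeff_X_pow_mul_expandFive, coeff_quinsect]
  rw [Finset.sum_eq_single (n % 5), if_pos (by omega)]
  · rw [show 5 * ((n - n % 5) / 5) + n % 5 = n by omega]
  · intro j hj hne
    rw [Finset.mem_range] at hj
    exact if_neg (by omega)
  · intro h
    exact absurd (Finset.mem_range.2 (Nat.mod_lt _ (by norm_num))) h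

theorem quinsect_expandFive_mul {r : ℕ} (hr : r < 5) (g f : ℤ⟦X⟧) :
    quinsect r (expandFive g * f) = g * quinsect r f := by
  conv_lhs => rw [sum_X_pow_mul_expandFive_quinsect f]
  rw [Finset.mul_sum, map_sum, Finset.sum_eq_single r]
  · rw [show expandFive g * (X ^ r * expandFive (quinsect r f)) =
      X ^ (5 * 0 + r) * expandFive (g * quinsect r f) by rw [map_mul]; ring,
      quinsect_X_pow_mul_expandFive, pow_zero, one_mul]
  · intro j hj hne
    rw [Finset.mem_range] at hj
    rw [show expandFive g * (X ^ j * expandFive (quinsect j f)) =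
      X ^ j * expandFive (g * quinsect j f) by rw [map_mul]; ring]
    exact quinsect_X_pow_mul_expandFive_of_ne (by omega) _
  · intro h
    exact absurd (Finset.mem_range.2 hr) h

/-! ### Pentagonal numbers modulo 5 and the dissection of Euler's product -/

theorem abs_le_pentagonal (a : ℤ) : |a| ≤ pentagonal a := by
  have h := two_mul_natCast_pentagonal a
  rcases abs_cases a with ⟨h1, h2⟩ | ⟨h1, h2⟩ <;> rw [h1]
  · rcases h2.eq_or_lt with h3 | h3
    · subst h3; simp
    · nlinarith
  · nlinarith

theorem pentagonal_emod_five (a : ℤ) :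
    (a % 5 = 0 ∧ pentagonal a % 5 = 0) ∨ (a % 5 = 1 ∧ pentagonal a % 5 = 1) ∨
    (a % 5 = 2 ∧ pentagonal a % 5 = 0) ∨ (a % 5 = 3 ∧ pentagonal a % 5 = 2) ∨
    (a % 5 = 4 ∧ pentagonal a % 5 = 2) := by
  have h := two_mul_natCast_pentagonal a
  have h1 : (a * (3 * a - 1)) % 5 = ((a % 5) * (3 * (a % 5) - 1)) % 5 := by
    simp [Int.mul_emod, Int.sub_emod]
  have h2 : a % 5 = 0 ∨ a % 5 = 1 ∨ a % 5 = 2 ∨ a % 5 = 3 ∨ a % 5 = 4 := by omega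
  rw [← h] at h1
  rcases h2 with h2 | h2 | h2 | h2 | h2 <;> rw [h2] at h1 <;> norm_num at h1 <;> omega

theorem coeff_eulerSeries_eq_sum {m N : ℕ} (h : m ≤ N) :
    coeff m eulerSeries =
      ∑ a ∈ Finset.Icc (-(N : ℤ)) N, if pentagonal a = m then (Int.negOnePow a : ℤ) else 0 := by
  by_cases hm : m ∈ Set.range pentagonal
  · obtain ⟨k, rfl⟩ := hm
    rw [Finset.sum_eq_single k]
    · rw [if_pos rfl, coeff_pentagonalSeries_pentagonal, Int.cast_id]
    · intro b _ hb
      rw [if_neg (by simpa using hb)]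
    · intro hk
      have := abs_le.1 ((abs_le_pentagonal k).trans (Nat.cast_le.2 h : _ ≤ (N : ℤ)))
      exact absurd (Finset.mem_Icc.2 this) hk
  · rw [coeff_pentagonalSeries_eq_zero _ hm, Finset.sum_eq_zero]
    intro a _
    exact if_neg fun h => hm ⟨a, h⟩

/-- Both indices run over a window depending only on `5 * n + r + s`, so that products of different
sections can be compared as sums over the same pairs. The residue of `pentagonal b` follows from the
other conditions; only `s ≤ pentagonal b` must be kept. -/
theorem coeff_quinsect_mul_quinsect {r s : ℕ} (hr : r < 5) (n : ℕ) :
    coeff n (quinsect r eulerSeries * quinsect s eulerSeries) =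
      ∑ a ∈ Finset.Icc (-((5 * n + r + s : ℕ) : ℤ)) (5 * n + r + s : ℕ),
      ∑ b ∈ Finset.Icc (-((5 * n + r + s : ℕ) : ℤ)) (5 * n + r + s : ℕ),
        if pentagonal a % 5 = r ∧ s ≤ pentagonal b ∧ pentagonal a + pentagonal b = 5 * n + r + s
        then (Int.negOnePow a : ℤ) * Int.negOnePow b else 0 := by
  have h1 : ∀ p ∈ Finset.HasAntidiagonal.antidiagonal n,
      coeff p.1 (quinsect r eulerSeries) * coeff p.2 (quinsect s eulerSeries) =
      ∑ a ∈ Finset.Icc (-((5 * n + r + s : ℕ) : ℤ)) (5 * n + r + s : ℕ),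
      ∑ b ∈ Finset.Icc (-((5 * n + r + s : ℕ) : ℤ)) (5 * n + r + s : ℕ),
        if pentagonal a = 5 * p.1 + r ∧ pentagonal b = 5 * p.2 + s
        then (Int.negOnePow a : ℤ) * Int.negOnePow b else 0 := by
    intro p hp
    rw [Finset.HasAntidiagonal.mem_antidiagonal] at hp
    rw [coeff_quinsect, coeff_quinsect,
      coeff_eulerSeries_eq_sum (show 5 * p.1 + r ≤ 5 * n + r + s by omega),
      coeff_eulerSeries_eq_sum (show 5 * p.2 + s ≤ 5 * n + r + s by omega), Finset.sum_mul_sum]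
    refine Finset.sum_congr rfl fun a _ => Finset.sum_congr rfl fun b _ => ?_
    rw [ite_and]
    split_ifs <;> simp
  rw [coeff_mul, Finset.sum_congr rfl h1, Finset.sum_comm]
  refine Finset.sum_congr rfl fun a _ => ?_
  rw [Finset.sum_comm]
  refine Finset.sum_congr rfl fun b _ => ?_
  split_ifs with h
  · rw [Finset.sum_eq_single (pentagonal a / 5, (pentagonal b - s) / 5), if_pos (by omega)]
    · rintro ⟨i, j⟩ hp hne
      refine if_neg fun h' => hne ?_
      rw [Prod.mk.injEq]
      dsimp only at h'
      omega
    · intro h'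
      exact absurd (Finset.HasAntidiagonal.mem_antidiagonal.2 (by dsimp only; omega)) h'
  · refine Finset.sum_eq_zero ?_
    rintro ⟨i, j⟩ hp
    rw [Finset.HasAntidiagonal.mem_antidiagonal] at hp
    dsimp only at hp
    refine if_neg fun h' => h ?_
    dsimp only at h'
    omega

/-- With x = 6a - 1 and y = 6b - 1, the sum of the two pentagonal numbers is (x^2 + y^2 - 2)/24, and
the congruence says y ≡ 2x modulo 5. The reflection (x, y) ↦ ((3x - 4y)/5, (-4x - 3y)/5) is then
integral, preserves x^2 + y^2 and the congruence, and changes the parity of a + b, so the terms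
cancel in pairs. -/
theorem sum_negOnePow_pentagonal_pairs_eq_zero (m : ℕ) :
    ∑ p ∈ (Finset.Icc (-(m : ℤ)) m ×ˢ Finset.Icc (-(m : ℤ)) m) with
        (p.2 - 2 * p.1 + 1) % 5 = 0 ∧ pentagonal p.1 + pentagonal p.2 = m,
      (Int.negOnePow p.1 : ℤ) * Int.negOnePow p.2 = 0 := by
  have key : ∀ a b c d : ℤ, 5 * c = 3 * a - 4 * b + 1 → 5 * d = -4 * a - 3 * b + 2 →
      (Int.negOnePow a : ℤ) * Int.negOnePow b + Int.negOnePow c * Int.negOnePow d = 0 ∧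
      pentagonal c + pentagonal d = pentagonal a + pentagonal b := by
    intro a b c d hc hd
    constructor
    · have h2 : ∃ t, c + d = a + b + (2 * t + 1) := ⟨(c + d - a - b - 1) / 2, by omega⟩
      obtain ⟨t, ht⟩ := h2
      have h3 : Int.negOnePow c * Int.negOnePow d = -(Int.negOnePow a * Int.negOnePow b) := by
        rw [← Int.negOnePow_add, ← Int.negOnePow_add, ht, Int.negOnePow_add,
          Int.negOnePow_odd _ ⟨t, rfl⟩]
        simp
      have h4 := congrArg (Units.val) h3
      push_cast at h4
      rw [h4]
      ring
    · have ha := two_mul_natCast_pentagonal a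
      have hb := two_mul_natCast_pentagonal b
      have h1 := two_mul_natCast_pentagonal c
      have h2 := two_mul_natCast_pentagonal d
      zify
      have hc' : (5 * c) * (3 * (5 * c) - 5) = (3 * a - 4 * b + 1) * (3 * (3 * a - 4 * b + 1) - 5) := by
        rw [hc]
      have hd' : (5 * d) * (3 * (5 * d) - 5) = (-4 * a - 3 * b + 2) * (3 * (-4 * a - 3 * b + 2) - 5) := by
        rw [hd]
      linarith
  refine Finset.sum_involution
    (fun p _ => ((3 * p.1 - 4 * p.2 + 1) / 5, (-4 * p.1 - 3 * p.2 + 2) / 5)) ?_ ?_ ?_ ?_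
  · rintro ⟨a, b⟩ hp
    obtain ⟨-, h1, -⟩ := Finset.mem_filter.1 hp
    dsimp only at h1 ⊢
    exact (key a b _ _ (by omega) (by omega)).1
  · rintro ⟨a, b⟩ hp hne heq
    obtain ⟨-, h1, -⟩ := Finset.mem_filter.1 hp
    dsimp only at h1 hne
    rw [Prod.mk.injEq] at heq
    have := (key a b a b (by omega) (by omega)).1
    omega
  · rintro ⟨a, b⟩ hp
    simp only [Finset.mem_filter] at hp ⊢
    have h := (key a b ((3 * a - 4 * b + 1) / 5) ((-4 * a - 3 * b + 2) / 5)
      (by omega) (by omega)).2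
    refine ⟨?_, by omega, by omega⟩
    simp only [Finset.mem_product, Finset.mem_Icc, ← abs_le]
    have h1 := abs_le_pentagonal ((3 * a - 4 * b + 1) / 5)
    have h2 := abs_le_pentagonal ((-4 * a - 3 * b + 2) / 5)
    omega
  · rintro ⟨a, b⟩ hp
    simp only [Finset.mem_filter] at hp
    rw [Prod.mk.injEq]
    dsimp only
    omega

/-- The residues of (a, b) modulo 5 occurring in the product of sections 0 and 2 are (0,4), (2,3),
(0,3), (2,4). The first two satisfy b ≡ 2a - 1; the other two do so after exchanging a and b, whence
the swapped signs in the second term. -/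
theorem ite_pentagonal_eq_add (n : ℕ) (a b : ℤ) :
    (if pentagonal a % 5 = 0 ∧ 2 ≤ pentagonal b ∧ pentagonal a + pentagonal b = 5 * n + 2
        then (Int.negOnePow a : ℤ) * Int.negOnePow b else 0) =
      (if (b - 2 * a + 1) % 5 = 0 ∧ pentagonal a % 5 = 0 ∧ pentagonal a + pentagonal b = 5 * n + 2
        then (Int.negOnePow a : ℤ) * Int.negOnePow b else 0) +
      (if (b - 2 * a + 1) % 5 ≠ 0 ∧ pentagonal a % 5 = 0 ∧ pentagonal a + pentagonal b = 5 * n + 2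
        then (Int.negOnePow b : ℤ) * Int.negOnePow a else 0) := by
  have ha := pentagonal_emod_five a
  have hb := pentagonal_emod_five b
  rw [mul_comm (Int.negOnePow b : ℤ)]
  generalize (Int.negOnePow a : ℤ) * Int.negOnePow b = w
  generalize pentagonal a = x at *
  generalize pentagonal b = y at *
  split_ifs <;> omega

/-- The line b ≡ 2a - 1 modulo 5 consists of (0,4), (2,3), the swapped pairs (3,0), (4,2), and
(1,1). The last is exactly the square of section 1, so the three terms together fill the domain of
the reflection. -/
theorem ite_pentagonal_add_add (n : ℕ) (a b : ℤ) :
    (if (b - 2 * a + 1) % 5 = 0 ∧ pentagonal a % 5 = 0 ∧ pentagonal a + pentagonal b = 5 * n + 2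
        then (Int.negOnePow a : ℤ) * Int.negOnePow b else 0) +
      (if (a - 2 * b + 1) % 5 ≠ 0 ∧ pentagonal b % 5 = 0 ∧
          pentagonal b + pentagonal a = 5 * n + 2
        then (Int.negOnePow a : ℤ) * Int.negOnePow b else 0) +
      (if pentagonal a % 5 = 1 ∧ 1 ≤ pentagonal b ∧ pentagonal a + pentagonal b = 5 * n + 2
        then (Int.negOnePow a : ℤ) * Int.negOnePow b else 0) =
      if (b - 2 * a + 1) % 5 = 0 ∧ pentagonal a + pentagonal b = 5 * n + 2
        then (Int.negOnePow a : ℤ) * Int.negOnePow b else 0 := by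
  have ha := pentagonal_emod_five a
  have hb := pentagonal_emod_five b
  generalize (Int.negOnePow a : ℤ) * Int.negOnePow b = w
  generalize pentagonal a = x at *
  generalize pentagonal b = y at *
  split_ifs <;> omega

theorem quinsect_zero_mul_quinsect_two :
    quinsect 0 eulerSeries * quinsect 2 eulerSeries = -quinsect 1 eulerSeries ^ 2 := by
  rw [eq_neg_iff_add_eq_zero, sq]
  ext n
  rw [map_add, coeff_quinsect_mul_quinsect (by norm_num), coeff_quinsect_mul_quinsect (by norm_num),
    map_zero]
  simp only [add_zero, show 5 * n + 1 + 1 = 5 * n + 2 from rfl]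
  have hz := sum_negOnePow_pentagonal_pairs_eq_zero (5 * n + 2)
  rw [Finset.sum_filter, Finset.sum_product] at hz
  generalize hI : Finset.Icc (-((5 * n + 2 : ℕ) : ℤ)) (5 * n + 2 : ℕ) = I at hz ⊢
  rw [Finset.sum_congr rfl fun a _ => Finset.sum_congr rfl fun b _ =>
    ite_pentagonal_eq_add n a b]
  simp only [Finset.sum_add_distrib]
  rw [Finset.sum_comm (f := fun a b => if (b - 2 * a + 1) % 5 ≠ 0 ∧ pentagonal a % 5 = 0 ∧
        pentagonal a + pentagonal b = 5 * n + 2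
        then (Int.negOnePow b : ℤ) * Int.negOnePow a else 0), ← Finset.sum_add_distrib,
    ← Finset.sum_add_distrib]
  refine Eq.trans ?_ hz
  refine Finset.sum_congr rfl fun a _ => ?_
  rw [← Finset.sum_add_distrib, ← Finset.sum_add_distrib]
  exact Finset.sum_congr rfl fun b _ => ite_pentagonal_add_add n a b

theorem quinsect_one_eulerSeries : quinsect 1 eulerSeries = -expandFive eulerSeries := by
  ext n
  rw [coeff_quinsect, map_neg, coeff_expand]
  -- Only indices a ≡ 1 modulo 5 contribute to section 1, and this identity turns them into all
  -- pentagonal numbers again.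
  have aux : ∀ k : ℤ, pentagonal (5 * k + 1) = 25 * pentagonal (-k) + 1 := by
    intro k
    have h1 := two_mul_natCast_pentagonal (5 * k + 1)
    have h2 := two_mul_natCast_pentagonal_neg k
    zify
    linarith
  by_cases h : 5 * n + 1 ∈ Set.range pentagonal
  · obtain ⟨a, ha⟩ := h
    obtain ⟨k, rfl⟩ : ∃ k, a = 5 * k + 1 := ⟨a / 5, by have := pentagonal_emod_five a; omega⟩
    have hk := aux k
    rw [← ha, coeff_pentagonalSeries_pentagonal, if_pos (by omega),
      show n / 5 = pentagonal (-k) by omega, coeff_pentagonalSeries_pentagonal]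
    rw [Int.negOnePow_neg, Int.negOnePow_succ, show 5 * k = k + 2 * (2 * k) by ring,
      Int.negOnePow_add, Int.negOnePow_two_mul, mul_one]
    simp
  · rw [coeff_pentagonalSeries_eq_zero _ h]
    split_ifs with hn
    · rw [coeff_pentagonalSeries_eq_zero, neg_zero]
      rintro ⟨k, hk⟩
      have := aux (-k)
      rw [neg_neg] at this
      exact h ⟨5 * (-k) + 1, by omega⟩
    · simp

theorem quinsect_three_eulerSeries : quinsect 3 eulerSeries = 0 := by
  ext n
  rw [coeff_quinsect, coeff_pentagonalSeries_eq_zero, map_zero]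
  rintro ⟨a, ha⟩
  have := pentagonal_emod_five a
  omega

theorem quinsect_four_eulerSeries : quinsect 4 eulerSeries = 0 := by
  ext n
  rw [coeff_quinsect, coeff_pentagonalSeries_eq_zero, map_zero]
  rintro ⟨a, ha⟩
  have := pentagonal_emod_five a
  omega

theorem eulerSeries_eq_dissection :
    eulerSeries = expandFive (quinsect 0 eulerSeries) - X * expandFive (expandFive eulerSeries) +
      X ^ 2 * expandFive (quinsect 2 eulerSeries) := by
  conv_lhs => rw [sum_X_pow_mul_expandFive_quinsect eulerSeries]
  simp only [Finset.sum_range_succ, Finset.sum_range_zero, quinsect_one_eulerSeries,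
    quinsect_three_eulerSeries, quinsect_four_eulerSeries, map_zero, map_neg]
  ring

/-! ### The norm of Euler's product over the fifth roots of unity -/

theorem prod_quadratic_of_primitiveRoot {K : Type*} [Field K] {w : K}
    (hw : IsPrimitiveRoot w 5) (a b c : K⟦X⟧) :
    ∏ k ∈ Finset.range 5, (a + C (w ^ k) * b + C (w ^ k) ^ 2 * c) =
      a ^ 5 + b ^ 5 + c ^ 5 - 5 * a * b ^ 3 * c + 5 * a ^ 2 * b * c ^ 2 := by
  have h : 1 + w + w ^ 2 + w ^ 3 + w ^ 4 = 0 := by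
    simpa [Finset.sum_range_succ] using hw.geom_sum_eq_zero (by norm_num)
  have h' := congrArg (C (R := K)) h
  simp only [map_add, map_pow, map_one, map_zero] at h'
  simp only [Finset.prod_range_succ, Finset.prod_range_zero, map_pow]
  generalize C (R := K) w = u at h'
  have h5 : u ^ 5 = 1 := by linear_combination (u - 1) * h'
  -- Inverse roots are paired, so that only p = u + u^4 and its conjugate -1 - p remain, with p^2 =
  -- 1 - p.
  have h14 : (a + u ^ 1 * b + (u ^ 1) ^ 2 * c) * (a + u ^ 4 * b + (u ^ 4) ^ 2 * c) =
      a ^ 2 + b ^ 2 + c ^ 2 + (u + u ^ 4) * (a * b + b * c) + (u ^ 2 + u ^ 3) * (a * c) := by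
    linear_combination
      (b ^ 2 + a * c * u ^ 3 + b * c * (u + u ^ 4) + c ^ 2 * (u ^ 5 + 1)) * h5
  have h23 : (a + u ^ 2 * b + (u ^ 2) ^ 2 * c) * (a + u ^ 3 * b + (u ^ 3) ^ 2 * c) =
      a ^ 2 + b ^ 2 + c ^ 2 + (u ^ 2 + u ^ 3) * (a * b + b * c) + (u + u ^ 4) * (a * c) := by
    linear_combination
      (b ^ 2 + a * c * u + b * c * (u ^ 2 + u ^ 3) + c ^ 2 * (u ^ 5 + 1)) * h5
  have hq : u ^ 2 + u ^ 3 = -1 - (u + u ^ 4) := by linear_combination h'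
  have hp : (u + u ^ 4) ^ 2 = 1 - (u + u ^ 4) := by
    linear_combination h' + (u ^ 3 + 2) * h5
  rw [hq] at h14 h23
  generalize u + u ^ 4 = p at h14 h23 hp
  calc _ = (a + b + c) * ((a + u ^ 1 * b + (u ^ 1) ^ 2 * c) * (a + u ^ 4 * b + (u ^ 4) ^ 2 * c)) *
        ((a + u ^ 2 * b + (u ^ 2) ^ 2 * c) * (a + u ^ 3 * b + (u ^ 3) ^ 2 * c)) := by ring
    _ = _ := by
      rw [h14, h23]
      linear_combination (-(a + b + c) * (a * b + b * c - a * c) ^ 2) * hp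

theorem prod_sub_of_primitiveRoot {K : Type*} [Field K] {w : K}
    (hw : IsPrimitiveRoot w 5) (a b : K⟦X⟧) :
    ∏ k ∈ Finset.range 5, (a - C (w ^ k) * b) = a ^ 5 - b ^ 5 := by
  have h := prod_quadratic_of_primitiveRoot hw a (-b) 0
  simp only [mul_neg, mul_zero, add_zero, ← sub_eq_add_neg] at h
  rw [h]
  ring

section Topology
open scoped PowerSeries.WithPiTopology

theorem continuous_rescale {R : Type*} [CommRing R] [TopologicalSpace R] [IsTopologicalRing R]
    (c : R) : Continuous (rescale c) := by
  rw [continuous_iff_continuousAt]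
  intro f
  refine (WithPiTopology.tendsto_iff_coeff_tendsto _ _ _ _).2 fun d => ?_
  simp only [coeff_rescale]
  exact ((WithPiTopology.continuous_coeff R d).tendsto f).const_mul _

theorem continuous_expand {R : Type*} [CommRing R] [TopologicalSpace R] {p : ℕ} (hp : p ≠ 0) :
    Continuous (expand p hp : R⟦X⟧ →ₐ[R] R⟦X⟧) := by
  rw [continuous_iff_continuousAt]
  intro f
  refine (WithPiTopology.tendsto_iff_coeff_tendsto _ _ _ _).2 fun d => ?_
  simp only [coeff_expand]
  split_ifs
  · exact (WithPiTopology.continuous_coeff R _).tendsto f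
  · exact tendsto_const_nhds

/-- The product over k of 1 - w^(km) q^m is (1 - q^m)^5 when 5 divides m and 1 - q^(5m) otherwise.
The products for q^5 and q^25 are reindexed over all m with trivial factors inserted, so the
identity holds factor by factor. -/
theorem prod_rescale_pentagonalSeries {w : ℂ} (hw : IsPrimitiveRoot w 5) :
    (∏ k ∈ Finset.range 5, rescale (w ^ k) (pentagonalSeries ℂ)) *
      expand 25 (by norm_num) (pentagonalSeries ℂ) =
    expand 5 (by norm_num) (pentagonalSeries ℂ) ^ 6 := by
  have hE := WithPiTopology.hasProd_one_sub_X_pow ℂ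
  have h5 : HasProd (fun n : ℕ => (1 - X ^ (5 * (n + 1)) : ℂ⟦X⟧))
      (expand 5 (by norm_num) (pentagonalSeries ℂ)) := by
    convert hE.map (expand 5 (Nat.succ_ne_zero 4) : ℂ⟦X⟧ →ₐ[ℂ] ℂ⟦X⟧) (continuous_expand _) using 2 with n
    rw [Function.comp_apply, map_sub, map_one, map_pow, expand_X, ← pow_mul]
  have h25 : HasProd (fun n : ℕ => (1 - X ^ (25 * (n + 1)) : ℂ⟦X⟧))
      (expand 25 (by norm_num) (pentagonalSeries ℂ)) := by
    convert hE.map (expand 25 (Nat.succ_ne_zero 24) : ℂ⟦X⟧ →ₐ[ℂ] ℂ⟦X⟧) (continuous_expand _) using 2 with n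
    rw [Function.comp_apply, map_sub, map_one, map_pow, expand_X, ← pow_mul]
  have hinj : Function.Injective fun n : ℕ => 5 * n + 4 := fun a b h => by
    dsimp only at h
    omega
  have hrange : ∀ n, n ∉ Set.range (fun n : ℕ => 5 * n + 4) → ¬ 5 ∣ n + 1 := by
    intro n hn hd
    exact hn ⟨n / 5, by dsimp only; omega⟩
  have h25' : HasProd (fun n : ℕ => if 5 ∣ n + 1 then (1 - X ^ (5 * (n + 1)) : ℂ⟦X⟧) else 1)
      (expand 25 (by norm_num) (pentagonalSeries ℂ)) := by
    rw [← hinj.hasProd_iff fun n hn => if_neg (hrange n hn)]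
    convert h25 using 2 with n
    rw [Function.comp_apply, if_pos ⟨n + 1, by ring⟩]
    ring_nf
  have h5' : HasProd (fun n : ℕ => if 5 ∣ n + 1 then (1 - X ^ (n + 1) : ℂ⟦X⟧) else 1)
      (expand 5 (by norm_num) (pentagonalSeries ℂ)) := by
    rw [← hinj.hasProd_iff fun n hn => if_neg (hrange n hn)]
    convert h5 using 2 with n
    rw [Function.comp_apply, if_pos ⟨n + 1, by ring⟩]
    ring_nf
  have hr : HasProd (fun n : ℕ => ∏ k ∈ Finset.range 5, (1 - C (w ^ k) ^ (n + 1) * X ^ (n + 1) : ℂ⟦X⟧))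
      (∏ k ∈ Finset.range 5, rescale (w ^ k) (pentagonalSeries ℂ)) := by
    refine hasProd_prod fun k _ => ?_
    convert hE.map (rescale (w ^ k)) (continuous_rescale _) using 2 with n
    simp [rescale_X, mul_pow]
  have hL := hr.mul h25'
  have hpow : ∀ k : ℕ, HasProd
      (fun n : ℕ => (if 5 ∣ n + 1 then (1 - X ^ (n + 1) : ℂ⟦X⟧) else 1) ^ k)
      (expand 5 (by norm_num) (pentagonalSeries ℂ) ^ k) := by
    intro k
    induction k with
    | zero => simp
    | succ k ih => simpa only [pow_succ] using ih.mul h5'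
  have hR := (hpow 5).mul h5
  rw [pow_succ]
  refine hL.unique ?_
  convert hR using 2 with n
  by_cases hn : 5 ∣ n + 1
  · rw [if_pos hn, if_pos hn]
    congr 1
    have hwn : w ^ (n + 1) = 1 := (hw.pow_eq_one_iff_dvd _).2 hn
    have : ∀ k, C (w ^ k) ^ (n + 1) = (1 : ℂ⟦X⟧) := by
      intro k
      rw [← map_pow, ← pow_mul, mul_comm, pow_mul, hwn, one_pow, map_one]
    simp only [this, one_mul, Finset.prod_const, Finset.card_range]
  · rw [if_neg hn, if_neg hn, one_pow, mul_one, one_mul]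
    have hp : IsPrimitiveRoot (w ^ (n + 1)) 5 := hw.pow_of_coprime _
      ((Nat.coprime_comm.1 ((Nat.Prime.coprime_iff_not_dvd (by norm_num)).2 hn)))
    have := prod_sub_of_primitiveRoot hp 1 (X ^ (n + 1))
    rw [one_pow, ← pow_mul, mul_comm (n + 1)] at this
    rw [← this]
    refine Finset.prod_congr rfl fun k _ => ?_
    rw [← map_pow, ← pow_mul, ← pow_mul, mul_comm k]

end Topology

theorem map_pentagonalSeries {R S : Type*} [CommRing R] [CommRing S] (φ : R →+* S) :
    PowerSeries.map φ (pentagonalSeries R) = pentagonalSeries S := by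
  ext n
  rw [coeff_map]
  by_cases h : n ∈ Set.range pentagonal
  · obtain ⟨k, rfl⟩ := h
    simp
  · rw [coeff_pentagonalSeries_eq_zero _ h, coeff_pentagonalSeries_eq_zero _ h, map_zero]

theorem rescale_expand_of_pow_eq_one {R : Type*} [CommRing R] {c : R} {p : ℕ} (hp : p ≠ 0)
    (h : c ^ p = 1) (f : R⟦X⟧) : rescale c (expand p hp f) = expand p hp f := by
  ext n
  rw [coeff_rescale, coeff_expand]
  split_ifs with hn
  · obtain ⟨m, rfl⟩ := hn
    rw [pow_mul, h, one_pow, one_mul]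
  · rw [mul_zero]

theorem expandFive_expandFive (f : ℤ⟦X⟧) :
    expandFive (expandFive f) = expand 25 (by norm_num) f := by
  rw [show expand 25 (by norm_num) f = expand (5 * 5) (by norm_num) f from rfl]
  exact (expand_mul 5 (by norm_num) 5 (by norm_num) f).symm

/-- The norm of Euler's product over the series in `X ^ 5`. -/
theorem norm_eulerSeries :
    (expandFive (quinsect 0 eulerSeries) ^ 5 +
      11 * X ^ 5 * (-expandFive (expandFive eulerSeries)) ^ 5 +
      X ^ 10 * expandFive (quinsect 2 eulerSeries) ^ 5) * expandFive (expandFive eulerSeries) =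
    expandFive eulerSeries ^ 6 := by
  obtain ⟨w, hw⟩ : ∃ w : ℂ, IsPrimitiveRoot w 5 := ⟨_, Complex.isPrimitiveRoot_exp 5 (by norm_num)⟩
  have hinj : Function.Injective (PowerSeries.map (Int.castRingHom ℂ)) :=
    PowerSeries.map_injective _ (RingHom.injective_int _)
  apply hinj
  have key := prod_rescale_pentagonalSeries hw
  have hdis := congrArg (PowerSeries.map (Int.castRingHom ℂ)) eulerSeries_eq_dissection
  have hac := congrArg (fun f => PowerSeries.map (Int.castRingHom ℂ) (expandFive f))
    quinsect_zero_mul_quinsect_two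
  rw [quinsect_one_eulerSeries] at hac
  rw [expandFive_expandFive] at hdis ⊢
  simp only [map_mul, map_neg, map_pow, map_add, map_sub, map_expand, map_pentagonalSeries, map_X,
    ← expandFive_expandFive, neg_sq] at hdis hac ⊢
  have hX : ∀ k, rescale (w ^ k) (X ^ 5 : ℂ⟦X⟧) = X ^ 5 := by
    intro k
    rw [map_pow, rescale_X, mul_pow, ← map_pow, ← pow_mul, mul_comm k, pow_mul, hw.pow_eq_one,
      one_pow, map_one, one_mul]
  have hfix : ∀ k (f : ℂ⟦X⟧), rescale (w ^ k) (expand 5 (by norm_num) f) =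
      expand 5 (by norm_num) f := fun k f =>
    rescale_expand_of_pow_eq_one _ (by rw [← pow_mul, mul_comm k, pow_mul, hw.pow_eq_one, one_pow]) f
  have hres : ∀ k, rescale (w ^ k) (pentagonalSeries ℂ) = _ := fun k =>
    (congrArg (rescale (w ^ k)) hdis).trans (by
      rw [map_add, map_sub, map_mul, map_mul, hfix, hfix, hfix, map_pow, rescale_X])
  have h25 : expand 25 (by norm_num) (pentagonalSeries ℂ) =
      expand 5 (by norm_num) (expand 5 (by norm_num) (pentagonalSeries ℂ)) :=
    expand_mul 5 (by norm_num) 5 (by norm_num) _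
  rw [Finset.prod_congr rfl fun k _ => hres k, h25] at key
  rw [← key]
  generalize expand 5 _ (PowerSeries.map (Int.castRingHom ℂ) (quinsect 0 eulerSeries)) = a at *
  generalize expand 5 _ (PowerSeries.map (Int.castRingHom ℂ) (quinsect 2 eulerSeries)) = c at *
  generalize expand 5 _ (expand 5 _ (pentagonalSeries ℂ)) = e at *
  have hprod := prod_quadratic_of_primitiveRoot hw a (-(X * e)) (X ^ 2 * c)
  have hrw : ∀ k, a - C (w ^ k) * X * e + (C (w ^ k) * X) ^ 2 * c =
      a + C (w ^ k) * -(X * e) + C (w ^ k) ^ 2 * (X ^ 2 * c) := fun k => by ring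
  rw [Finset.prod_congr rfl fun k _ => hrw k, hprod, map_ofNat]
  -- With b = -Xe and X^2 c in place of c, the relation reads a·c = -b^2. Both mixed terms of the
  -- product then equal 5b^5, which gives the coefficient 11 = 1 + 5 + 5.
  linear_combination (-e) * (5 * X ^ 5 * e ^ 3 - 5 * X ^ 5 * e * (a * c - e ^ 2)) * hac

/-! ### The generating series of colored partitions -/

/-- A colored partition amounts to one ordinary partition for each color. -/
noncomputable def ColoredPartition.ofPartitions {k n : ℕ}
    (q : Σ l : {l : Fin k →₀ ℕ // l ∈ Finset.finsuppAntidiag Finset.univ n},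
      ∀ c, Nat.Partition (l.1 c)) : ColoredPartition k n where
  parts := ∑ c, (q.2 c).parts.map fun i => (i, c)
  parts_pos x hx := by
    obtain ⟨c, -, hc⟩ := Multiset.mem_sum.1 hx
    obtain ⟨i, hi, rfl⟩ := Multiset.mem_map.1 hc
    exact (q.2 c).parts_pos hi
  parts_sum := by
    rw [← Multiset.coe_mapAddMonoidHom, map_sum, Multiset.sum_sum]
    have := (Finset.mem_finsuppAntidiag.1 q.1.2).1
    simpa [Multiset.map_map, Function.comp_def, (q.2 _).parts_sum] using this

theorem Multiset.map_fst_filter_sum_map {k : ℕ} (f : Fin k → Multiset ℕ) (c : Fin k) :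
    ((∑ d, (f d).map fun i => (i, d)).filter (fun x => x.2 = c)).map Prod.fst = f c := by
  have h : (∑ d, (f d).map fun i => (i, d)).filter (fun x => x.2 = c) =
      ∑ d, ((f d).map fun i => (i, d)).filter (fun x => x.2 = c) :=
    map_sum (⟨⟨Multiset.filter fun x : ℕ × Fin k => x.2 = c, Multiset.filter_zero _⟩,
      Multiset.filter_add _⟩ : Multiset (ℕ × Fin k) →+ Multiset (ℕ × Fin k)) _ _
  rw [h, ← Multiset.coe_mapAddMonoidHom, map_sum, Finset.sum_eq_single c]
  · simp [Multiset.filter_map]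
  · intro d _ hd
    simp [Multiset.filter_map, hd]
  · simp

theorem ColoredPartition.ofPartitions_bijective (k n : ℕ) :
    Function.Bijective (ColoredPartition.ofPartitions (k := k) (n := n)) := by
  constructor
  · rintro ⟨⟨l, hl⟩, f⟩ ⟨⟨m, hm⟩, g⟩ h
    have hparts : ∀ c, (f c).parts = (g c).parts := by
      intro c
      have h1 := Multiset.map_fst_filter_sum_map (fun c => (f c).parts) c
      have h2 := Multiset.map_fst_filter_sum_map (fun c => (g c).parts) c
      have h3 := congrArg ColoredPartition.parts h
      simp only [ofPartitions] at h3
      rw [← h1, h3, h2]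
    have hlm : l = m := by
      ext c
      rw [← (f c).parts_sum, hparts, (g c).parts_sum]
    subst hlm
    congr 1
    funext c
    exact Nat.Partition.ext (hparts c)
  · rintro ⟨s, hs, hsum⟩
    have hrec : ∑ c, ((s.filter (fun x => x.2 = c)).map Prod.fst).map (fun i => (i, c)) = s := by
      have h : ∀ c, ((s.filter (fun x => x.2 = c)).map Prod.fst).map (fun i => (i, c)) =
          s.filter (fun x => x.2 = c) := by
        intro c
        rw [Multiset.map_map]
        conv_rhs => rw [← Multiset.map_id (s.filter (fun x => x.2 = c))]
        refine Multiset.map_congr rfl fun x hx => ?_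
        exact Prod.ext rfl (Multiset.of_mem_filter hx).symm
      simp only [h]
      ext x
      simp [Multiset.count_sum', Multiset.count_filter]
    let l : Fin k → ℕ := fun c => ((s.filter (fun x => x.2 = c)).map Prod.fst).sum
    have hl : ∑ c, l c = n := by
      rw [← hsum]
      conv_rhs => rw [← hrec]
      rw [← Multiset.coe_mapAddMonoidHom, map_sum, Multiset.sum_sum]
      simp [Multiset.map_map, l]
    refine ⟨⟨⟨Finsupp.equivFunOnFinite.symm l, ?_⟩, fun c =>
      ⟨(s.filter (fun x => x.2 = c)).map Prod.fst, ?_, rfl⟩⟩, ?_⟩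
    · rw [Finset.mem_finsuppAntidiag]
      exact ⟨hl, Finset.subset_univ _⟩
    · intro i hi
      obtain ⟨x, hx, rfl⟩ := Multiset.mem_map.1 hi
      exact hs x (Multiset.mem_of_mem_filter hx)
    · simp only [ofPartitions, hrec]

/-- The generating series of the ordinary partitions. -/
noncomputable def partitionSeries : ℤ⟦X⟧ := PowerSeries.mk fun n => (Fintype.card n.Partition : ℤ)

theorem coloredPartitionCount_eq_coeff (k n : ℕ) :
    (coloredPartitionCount k n : ℤ) = coeff n (partitionSeries ^ k) := by
  have h : partitionSeries ^ k = ∏ _c : Fin k, partitionSeries := by simp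
  rw [h, coeff_prod, coloredPartitionCount,
    ← Nat.card_congr (Equiv.ofBijective _ (ColoredPartition.ofPartitions_bijective k n)),
    Nat.card_sigma]
  push_cast
  rw [Finset.sum_coe_sort (Finset.finsuppAntidiag Finset.univ n)
    fun l : Fin k →₀ ℕ => (Nat.card (∀ c, Nat.Partition (l c)) : ℤ)]
  simp [partitionSeries]

section Topology
open scoped PowerSeries.WithPiTopology

theorem eulerSeries_mul_partitionSeries : eulerSeries * partitionSeries = 1 := by
  have h1 : partitionSeries = Nat.Partition.genFun (fun _ _ => (1 : ℤ)) := by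
    ext n
    simp [partitionSeries, Finsupp.prod]
  have h2 := Nat.Partition.hasProd_genFun (fun _ _ => (1 : ℤ))
  have h3 := (WithPiTopology.hasProd_one_sub_X_pow ℤ).mul h2
  rw [h1]
  refine h3.unique ?_
  convert hasProd_one with n
  have h4 := WithPiTopology.one_sub_mul_tsum_pow_of_constantCoeff_eq_zero
    (f := (X : ℤ⟦X⟧) ^ (n + 1)) (by simp)
  refine Eq.trans (congrArg _ ?_) h4
  rw [(WithPiTopology.summable_pow_of_constantCoeff_eq_zero
    (f := (X : ℤ⟦X⟧) ^ (n + 1)) (by simp)).tsum_eq_zero_add, pow_zero]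
  simp only [PowerSeries.smul_eq_C_mul, map_one, one_mul, pow_mul]

end Topology

/-! ### Sections of small powers of Euler's product -/

theorem expandFive_eulerSeries_mul_partitionSeries :
    expandFive eulerSeries * expandFive partitionSeries = 1 := by
  rw [← map_mul, eulerSeries_mul_partitionSeries, map_one]

theorem quinsect_X_pow_mul {a r m : ℕ} (hr : r < 5) (h : a + r = 5 * m) (f : ℤ⟦X⟧) :
    quinsect 0 (X ^ a * f) = X ^ m * quinsect r f := by
  ext n
  rw [coeff_quinsect, coeff_X_pow_mul', coeff_X_pow_mul']
  by_cases hn : m ≤ n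
  · rw [if_pos (by omega), if_pos hn, coeff_quinsect,
      show 5 * n + 0 - a = 5 * (n - m) + r by omega]
  · rw [if_neg (by omega), if_neg hn]

theorem quinsect_eq_of_eq {f f0 f1 f2 f3 f4 : ℤ⟦X⟧}
    (h : f = expandFive f0 + X * expandFive f1 + X ^ 2 * expandFive f2 + X ^ 3 * expandFive f3 +
      X ^ 4 * expandFive f4) :
    quinsect 0 f = f0 ∧ quinsect 1 f = f1 ∧ quinsect 2 f = f2 ∧ quinsect 3 f = f3 ∧
      quinsect 4 f = f4 := by
  have hs : ∀ r < 5, ∀ g, quinsect r (X ^ r * expandFive g) = g := fun r hr g => by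
    simpa using quinsect_X_pow_mul_expandFive (r := r) 0 g
  have hn : ∀ {r j}, r < 5 → j < 5 → j ≠ r → ∀ g, quinsect r (X ^ j * expandFive g) = 0 :=
    fun hr hj hne g => quinsect_X_pow_mul_expandFive_of_ne (by omega) g
  rw [show f = X ^ 0 * expandFive f0 + X ^ 1 * expandFive f1 + X ^ 2 * expandFive f2 +
    X ^ 3 * expandFive f3 + X ^ 4 * expandFive f4 by rw [h]; ring]
  refine ⟨?_, ?_, ?_, ?_, ?_⟩ <;> simp only [map_add]
  · rw [hs 0, hn, hn, hn, hn] <;> first | omega | ring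
  · rw [hs 1, hn, hn, hn, hn] <;> first | omega | ring
  · rw [hs 2, hn, hn, hn, hn] <;> first | omega | ring
  · rw [hs 3, hn, hn, hn, hn] <;> first | omega | ring
  · rw [hs 4, hn, hn, hn, hn] <;> first | omega | ring

theorem expandFive_quinsect_zero_mul_quinsect_two :
    expandFive (quinsect 0 eulerSeries) * expandFive (quinsect 2 eulerSeries) =
      -expandFive (expandFive eulerSeries) ^ 2 := by
  rw [← map_mul, quinsect_zero_mul_quinsect_two, quinsect_one_eulerSeries, neg_sq, map_neg, map_pow]

theorem quinsect_two_eulerSeries_sq :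
    quinsect 2 (eulerSeries ^ 2) = -expandFive eulerSeries ^ 2 := by
  have hac := expandFive_quinsect_zero_mul_quinsect_two
  have hE := eulerSeries_eq_dissection
  generalize quinsect 0 eulerSeries = A at *
  generalize quinsect 2 eulerSeries = B at *
  refine (quinsect_eq_of_eq (f0 := A ^ 2) (f1 := -2 * A * expandFive eulerSeries)
    (f3 := -2 * expandFive eulerSeries * B) (f4 := B ^ 2) ?_).2.2.1
  simp only [map_mul, map_neg, map_pow, map_ofNat]
  generalize expandFive (expandFive eulerSeries) = e at *
  generalize eulerSeries = E at *
  rw [hE]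
  linear_combination 2 * X ^ 2 * hac

/-- Cubing the dissection and eliminating AB makes sections 2 and 4 cancel. This reflects Jacobi's
identity: E^3 is supported on triangular numbers, which are 0, 1 or 3 modulo 5. -/
theorem quinsect_eulerSeries_cube :
    quinsect 2 (eulerSeries ^ 3) = 0 ∧ quinsect 3 (eulerSeries ^ 3) = 5 * expandFive eulerSeries ^ 3 ∧
      quinsect 4 (eulerSeries ^ 3) = 0 := by
  have hac := expandFive_quinsect_zero_mul_quinsect_two
  have hE := eulerSeries_eq_dissection
  generalize quinsect 0 eulerSeries = A at *
  generalize quinsect 2 eulerSeries = B at *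
  refine (quinsect_eq_of_eq (f0 := A ^ 3 - 3 * X * expandFive eulerSeries * B ^ 2)
    (f1 := -3 * A ^ 2 * expandFive eulerSeries + X * B ^ 3) ?_).2.2
  simp only [map_mul, map_neg, map_pow, map_ofNat, map_add, map_sub, map_zero, expand_X]
  generalize expandFive (expandFive eulerSeries) = e at *
  generalize eulerSeries = E at *
  rw [hE]
  generalize expandFive A = a at *
  generalize expandFive B = c at *
  linear_combination (3 * X ^ 2 * a - 6 * X ^ 3 * e + 3 * X ^ 4 * c) * hac

theorem quinsect_four_eulerSeries_pow_four :
    quinsect 4 (eulerSeries ^ 4) = -5 * expandFive eulerSeries ^ 4 := by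
  have hac := expandFive_quinsect_zero_mul_quinsect_two
  have hE := eulerSeries_eq_dissection
  generalize quinsect 0 eulerSeries = A at *
  generalize quinsect 2 eulerSeries = B at *
  refine (quinsect_eq_of_eq (f0 := A ^ 4 + 8 * X * expandFive eulerSeries ^ 3 * B)
    (f1 := -4 * A ^ 3 * expandFive eulerSeries + 2 * X * expandFive eulerSeries ^ 2 * B ^ 2)
    (f2 := 2 * A ^ 2 * expandFive eulerSeries ^ 2 - 4 * X * expandFive eulerSeries * B ^ 3)
    (f3 := 8 * A * expandFive eulerSeries ^ 3 + X * B ^ 4) ?_).2.2.2.2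
  simp only [map_mul, map_neg, map_pow, map_ofNat, map_add, map_sub, expand_X]
  generalize expandFive (expandFive eulerSeries) = e at *
  generalize eulerSeries = E at *
  rw [hE]
  generalize expandFive A = a at *
  generalize expandFive B = c at *
  linear_combination (4 * X ^ 2 * a ^ 2 - 12 * X ^ 3 * a * e + X ^ 4 * (6 * a * c + 6 * e ^ 2)
    - 12 * X ^ 5 * e * c + 4 * X ^ 6 * c ^ 2) * hac

/-! ### The modular equation and the sections of powers of ζ -/

/-- The modular equation of degree five for Euler's product. -/
theorem modular_equation_eulerSeries :
    (eulerSeries ^ 5 + 5 * X * eulerSeries ^ 4 * expandFive (expandFive eulerSeries) +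
      15 * X ^ 2 * eulerSeries ^ 3 * expandFive (expandFive eulerSeries) ^ 2 +
      25 * X ^ 3 * eulerSeries ^ 2 * expandFive (expandFive eulerSeries) ^ 3 +
      25 * X ^ 4 * eulerSeries * expandFive (expandFive eulerSeries) ^ 4) *
      expandFive (expandFive eulerSeries) = expandFive eulerSeries ^ 6 := by
  have hac := expandFive_quinsect_zero_mul_quinsect_two
  have hE := eulerSeries_eq_dissection
  rw [← norm_eulerSeries]
  congr 1
  generalize quinsect 0 eulerSeries = A at *
  generalize quinsect 2 eulerSeries = B at *
  generalize expandFive (expandFive eulerSeries) = e at *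
  generalize eulerSeries = E at *
  rw [hE]
  generalize expandFive A = a at *
  generalize expandFive B = c at *
  -- The norm is symmetric in a and X^2 c, hence a polynomial in their sum E + Xe and their product
  -- -X^2 e^2.
  linear_combination (5 * X ^ 2 * (a + X ^ 2 * c) *
    ((a + X ^ 2 * c) ^ 2 - a * X ^ 2 * c + X ^ 2 * e ^ 2)) * hac

/-- The series `q ∏ (1 - q ^ (25 m)) / ∏ (1 - q ^ m)`. -/
noncomputable def zetaSeries : ℤ⟦X⟧ := X * expandFive (expandFive eulerSeries) * partitionSeries

/-- The series `q ∏ (1 - q ^ (5 m)) ^ 6 / ∏ (1 - q ^ m) ^ 6`. -/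
noncomputable def tauSeries : ℤ⟦X⟧ := X * expandFive eulerSeries ^ 6 * partitionSeries ^ 6

theorem zetaSeries_pow_five :
    zetaSeries ^ 5 = expandFive tauSeries * (1 + 5 * zetaSeries + 15 * zetaSeries ^ 2 +
      25 * zetaSeries ^ 3 + 25 * zetaSeries ^ 4) := by
  have h1 := eulerSeries_mul_partitionSeries
  have h2 := expandFive_eulerSeries_mul_partitionSeries
  have h3 := modular_equation_eulerSeries
  simp only [zetaSeries, tauSeries, map_mul, map_pow, expand_X]
  generalize expandFive (expandFive eulerSeries) = e at *
  generalize expandFive eulerSeries = F at *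
  generalize expandFive partitionSeries = Q at *
  generalize eulerSeries = E at *
  generalize partitionSeries = P at *
  calc (X * e * P) ^ 5 = X ^ 5 * e ^ 5 * P ^ 5 * (F * Q) ^ 6 := by rw [h2]; ring
    _ = X ^ 5 * e ^ 5 * Q ^ 6 * P ^ 5 * F ^ 6 := by ring
    _ = X ^ 5 * e ^ 6 * Q ^ 6 * ((E * P) ^ 5 + 5 * (X * e * P) * (E * P) ^ 4 +
        15 * (X * e * P) ^ 2 * (E * P) ^ 3 + 25 * (X * e * P) ^ 3 * (E * P) ^ 2 +
        25 * (X * e * P) ^ 4 * (E * P)) := by rw [← h3]; ring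
    _ = _ := by rw [h1]; ring

/-- The polynomials expressing the sections of the powers of `zetaSeries` through `tauSeries`;
the index is shifted by `4`. -/
noncomputable def sectionPoly : ℕ → Polynomial ℤ
  | 0 => Polynomial.C (-5)
  | 1 => Polynomial.C 5
  | 2 => Polynomial.C (-1)
  | 3 => Polynomial.C (-1)
  | 4 => Polynomial.C 1
  | k + 5 => Polynomial.X * (sectionPoly k + Polynomial.C 5 * sectionPoly (k + 1) +
      Polynomial.C 15 * sectionPoly (k + 2) + Polynomial.C 25 * sectionPoly (k + 3) +
      Polynomial.C 25 * sectionPoly (k + 4))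

/-- The factor q E^4 ζ^k equals q^5 E(q^25)^4 ζ^(k-4), so this computes U(ζ^(k-4)) without negative
powers. The exponents -4, …, 0 come from the sections of E^4, …, E^0; the modular equation supplies
the recurrence. Starting below 0 keeps the initial values constant. -/
theorem quinsect_zetaSeries_pow_aux (k : ℕ) :
    quinsect 0 (X * eulerSeries ^ 4 * zetaSeries ^ k) =
      X * expandFive eulerSeries ^ 4 * Polynomial.aeval tauSeries (sectionPoly k) := by
  have small : ∀ k r, k + r = 4 → quinsect 0 (X * eulerSeries ^ 4 * zetaSeries ^ k) =
      expandFive eulerSeries ^ k * (X * quinsect r (eulerSeries ^ r)) := by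
    intro k r hkr
    have h : X * eulerSeries ^ 4 * zetaSeries ^ k =
        expandFive (expandFive eulerSeries ^ k) * (X ^ (k + 1) * eulerSeries ^ r) := by
      rw [← hkr, zetaSeries, map_pow]
      calc _ = X ^ (k + 1) * eulerSeries ^ r * expandFive (expandFive eulerSeries) ^ k *
            (eulerSeries * partitionSeries) ^ k := by ring
        _ = _ := by rw [eulerSeries_mul_partitionSeries]; ring
    rw [h, quinsect_expandFive_mul (by norm_num),
      quinsect_X_pow_mul (r := r) (m := 1) (by omega) (by omega), pow_one]
  induction k using sectionPoly.induct with
  | case1 =>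
    rw [small 0 4 rfl, quinsect_four_eulerSeries_pow_four]
    rw [sectionPoly, Polynomial.aeval_C, eq_intCast]
    push_cast
    ring
  | case2 =>
    rw [small 1 3 rfl, quinsect_eulerSeries_cube.2.1]
    rw [sectionPoly, Polynomial.aeval_C, eq_intCast]
    push_cast
    ring
  | case3 =>
    rw [small 2 2 rfl, quinsect_two_eulerSeries_sq]
    rw [sectionPoly, Polynomial.aeval_C, eq_intCast]
    push_cast
    ring
  | case4 =>
    rw [small 3 1 rfl, pow_one, quinsect_one_eulerSeries]
    rw [sectionPoly, Polynomial.aeval_C, eq_intCast]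
    push_cast
    ring
  | case5 =>
    have h1 : quinsect 0 1 = 1 := by
      simpa using quinsect_X_pow_mul_expandFive (r := 0) 0 1
    rw [small 4 0 rfl, pow_zero, h1]
    rw [sectionPoly, Polynomial.aeval_C, eq_intCast]
    push_cast
    ring
  | case6 k h0 h1 h2 h3 h4 =>
    have h : X * eulerSeries ^ 4 * zetaSeries ^ (k + 5) =
        expandFive tauSeries * (X * eulerSeries ^ 4 * zetaSeries ^ k) +
        expandFive (5 * tauSeries) * (X * eulerSeries ^ 4 * zetaSeries ^ (k + 1)) +
        expandFive (15 * tauSeries) * (X * eulerSeries ^ 4 * zetaSeries ^ (k + 2)) +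
        expandFive (25 * tauSeries) * (X * eulerSeries ^ 4 * zetaSeries ^ (k + 3)) +
        expandFive (25 * tauSeries) * (X * eulerSeries ^ 4 * zetaSeries ^ (k + 4)) := by
      rw [pow_add _ k 5, zetaSeries_pow_five]
      simp only [map_mul, map_ofNat]
      ring
    rw [h]
    simp only [map_add, quinsect_expandFive_mul (show 0 < 5 by norm_num), h0, h1, h2, h3, h4]
    simp only [sectionPoly, map_add, map_mul, Polynomial.aeval_X, Polynomial.aeval_C]
    simp only [eq_intCast]
    push_cast
    ring

theorem quinsect_zetaSeries_pow (i : ℕ) :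
    quinsect 0 (zetaSeries ^ i) = Polynomial.aeval tauSeries (sectionPoly (i + 4)) := by
  have h := quinsect_zetaSeries_pow_aux (i + 4)
  have h1 : X * eulerSeries ^ 4 * zetaSeries ^ (i + 4) =
      expandFive (X * expandFive eulerSeries ^ 4) * zetaSeries ^ i := by
    rw [map_mul, map_pow, expand_X]
    calc _ = X * eulerSeries ^ 4 * zetaSeries ^ 4 * zetaSeries ^ i := by ring
      _ = X ^ 5 * expandFive (expandFive eulerSeries) ^ 4 * (eulerSeries * partitionSeries) ^ 4 *
          zetaSeries ^ i := by rw [zetaSeries]; ring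
      _ = _ := by rw [eulerSeries_mul_partitionSeries]; ring
  rw [h1, quinsect_expandFive_mul (by norm_num)] at h
  refine mul_left_cancel₀ (mul_ne_zero X_ne_zero (pow_ne_zero _ ?_)) h
  intro h0
  have := expandFive_eulerSeries_mul_partitionSeries
  rw [h0, zero_mul] at this
  exact zero_ne_one this

/-- The recurrence raises the index by at most 5 for each factor τ, so U(ζ^i) has order at least i/5
in τ. -/
theorem coeff_sectionPoly_eq_zero {k j : ℕ} (h : 5 * j + 4 < k) :
    (sectionPoly k).coeff j = 0 := by
  induction k using sectionPoly.induct generalizing j with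
  | case6 k h0 h1 h2 h3 h4 =>
    rw [sectionPoly]
    cases j with
    | zero => rw [Polynomial.coeff_X_mul_zero]
    | succ j =>
      rw [Polynomial.coeff_X_mul]
      simp only [Polynomial.coeff_add, Polynomial.coeff_C_mul]
      rw [h0 (by omega), h1 (by omega), h2 (by omega), h3 (by omega), h4 (by omega)]
      norm_num
  | _ => omega

/-- The coefficients 1, 5, 15, 25, 25 have valuations 0, 1, 1, 2, 2, which offset the loss in the
exponent when k is replaced by k + d for d = 0, …, 4. Truncated subtraction makes the claim empty
when 5j + 3 ≤ k. -/
theorem pow_dvd_coeff_sectionPoly (k j : ℕ) :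
    (5 : ℤ) ^ ((5 * j + 3 - k) / 2) ∣ (sectionPoly k).coeff j := by
  induction k using sectionPoly.induct generalizing j with
  | case6 k h0 h1 h2 h3 h4 =>
    rw [sectionPoly]
    cases j with
    | zero => simp
    | succ j =>
      rw [Polynomial.coeff_X_mul]
      simp only [Polynomial.coeff_add, Polynomial.coeff_C_mul]
      have lift : ∀ {d e a : ℕ} {c x : ℤ}, (5 : ℤ) ^ e ∣ x → (5 : ℤ) ^ a ∣ c → d ≤ a + e →
          (5 : ℤ) ^ d ∣ c * x := fun hx hc hd =>
        (pow_dvd_pow 5 hd).trans (by rw [pow_add]; exact mul_dvd_mul hc hx)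
      have t0 := (pow_dvd_pow (5 : ℤ) (show (5 * (j + 1) + 3 - (k + 5)) / 2 ≤ (5 * j + 3 - k) / 2
        by omega)).trans (h0 j)
      refine dvd_add (dvd_add (dvd_add (dvd_add t0 (lift (h1 j) (a := 1) ?_ ?_))
        (lift (h2 j) (a := 1) ?_ ?_)) (lift (h3 j) (a := 2) ?_ ?_)) (lift (h4 j) (a := 2) ?_ ?_)
      all_goals omega
  | _ =>
    cases j <;> simp [sectionPoly, Polynomial.coeff_one]

/-! ### The two operators on powers of τ -/

/-- Since τ(q)τ(q^5) = ζ^6 and U is linear over series in q^5, U(ζ^(6j)) = τ^j U(τ^j). Denominators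
are cleared by powers of E. -/
theorem quinsect_tauSeries_pow_mul (j : ℕ) :
    quinsect 0 (tauSeries ^ j) * tauSeries ^ j =
      Polynomial.aeval tauSeries (sectionPoly (6 * j + 4)) := by
  have h : expandFive (X ^ j * expandFive eulerSeries ^ (6 * j)) * tauSeries ^ j =
      expandFive (eulerSeries ^ (6 * j)) * zetaSeries ^ (6 * j) := by
    simp only [map_mul, map_pow, expand_X, tauSeries, zetaSeries]
    ring
  have h' := congrArg (quinsect 0) h
  rw [quinsect_expandFive_mul (by norm_num), quinsect_expandFive_mul (by norm_num),
    quinsect_zetaSeries_pow] at h'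
  calc _ = X ^ j * expandFive eulerSeries ^ (6 * j) * quinsect 0 (tauSeries ^ j) *
        partitionSeries ^ (6 * j) := by
        conv_lhs => enter [2]; rw [tauSeries]
        ring
    _ = Polynomial.aeval tauSeries (sectionPoly (6 * j + 4)) *
        (eulerSeries * partitionSeries) ^ (6 * j) := by rw [h']; ring
    _ = _ := by rw [eulerSeries_mul_partitionSeries, one_pow, mul_one]

/-- The extra factor ζ^7 = q^7 P^7 E(q^25)^7 turns the previous argument into one for the operator
twisted by q^7 P^7. -/
theorem quinsect_partitionSeries_pow_mul (i : ℕ) :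
    expandFive eulerSeries ^ 7 * quinsect 0 (X ^ 7 * partitionSeries ^ 7 * tauSeries ^ i) *
      tauSeries ^ i = Polynomial.aeval tauSeries (sectionPoly (6 * i + 11)) := by
  have h : expandFive (X ^ i * expandFive eulerSeries ^ (6 * i + 7)) *
      (X ^ 7 * partitionSeries ^ 7 * tauSeries ^ i) =
      expandFive (eulerSeries ^ (6 * i)) * zetaSeries ^ (6 * i + 7) := by
    simp only [map_mul, map_pow, expand_X, tauSeries, zetaSeries]
    ring
  have h' := congrArg (quinsect 0) h
  rw [quinsect_expandFive_mul (by norm_num), quinsect_expandFive_mul (by norm_num),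
    quinsect_zetaSeries_pow] at h'
  generalize quinsect 0 (X ^ 7 * partitionSeries ^ 7 * tauSeries ^ i) = G at *
  calc _ = X ^ i * expandFive eulerSeries ^ (6 * i + 7) * G * partitionSeries ^ (6 * i) := by
        conv_lhs => enter [2]; rw [tauSeries]
        ring
    _ = Polynomial.aeval tauSeries (sectionPoly (6 * i + 11)) *
        (eulerSeries * partitionSeries) ^ (6 * i) := by rw [h']; ring
    _ = _ := by rw [eulerSeries_mul_partitionSeries, one_pow, mul_one]

theorem tauSeries_ne_zero : tauSeries ≠ 0 := by
  have h1 := eulerSeries_mul_partitionSeries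
  have h2 := expandFive_eulerSeries_mul_partitionSeries
  refine mul_ne_zero (mul_ne_zero X_ne_zero (pow_ne_zero _ fun h => ?_)) (pow_ne_zero _ fun h => ?_)
  · rw [h, zero_mul] at h2
    exact zero_ne_one h2
  · rw [h, mul_zero] at h1
    exact zero_ne_one h1

/-- Cancels the power of τ left over by the two preceding identities; the shift of coefficients is
what the valuation estimates use. -/
theorem exists_aeval_eq_of_mul_pow {S : ℤ⟦X⟧} {p : Polynomial ℤ} {i : ℕ}
    (h : S * tauSeries ^ i = Polynomial.aeval tauSeries p) (hp : ∀ j < i, p.coeff j = 0) :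
    ∃ q : Polynomial ℤ, S = Polynomial.aeval tauSeries q ∧ ∀ j, q.coeff j = p.coeff (j + i) := by
  obtain ⟨q, rfl⟩ := Polynomial.X_pow_dvd_iff.2 hp
  refine ⟨q, ?_, fun j => by rw [Polynomial.coeff_X_pow_mul]⟩
  refine mul_right_cancel₀ (pow_ne_zero i tauSeries_ne_zero) ?_
  rw [h, map_mul, map_pow, Polynomial.aeval_X, mul_comm]

theorem pow_dvd_mul_of_le {d e a : ℕ} {c x : ℤ} (hx : (5 : ℤ) ^ e ∣ x) (hc : (5 : ℤ) ^ a ∣ c)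
    (h : d ≤ e + a) : (5 : ℤ) ^ d ∣ x * c :=
  (pow_dvd_pow 5 h).trans (by rw [pow_add]; exact mul_dvd_mul hx hc)

theorem exists_sum_aeval_eq (T : ℤ⟦X⟧ →+ ℤ⟦X⟧) {q : ℕ → Polynomial ℤ}
    (hq : ∀ j, T (tauSeries ^ j) = Polynomial.aeval tauSeries (q j)) (f : Polynomial ℤ) :
    ∃ g : Polynomial ℤ, T (Polynomial.aeval tauSeries f) = Polynomial.aeval tauSeries g ∧
      ∀ i, g.coeff i = ∑ j ∈ f.support, f.coeff j * (q j).coeff i := by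
  refine ⟨∑ j ∈ f.support, Polynomial.C (f.coeff j) * q j, ?_, fun i => ?_⟩
  · rw [Polynomial.aeval_eq_sum_range' (Nat.lt_succ_self _), map_sum, map_sum]
    symm
    refine (Finset.sum_subset (fun j hj => Finset.mem_range_succ_iff.2
      (Polynomial.le_natDegree_of_mem_supp j hj)) fun j _ hj => ?_).trans
      (Finset.sum_congr rfl fun j _ => ?_)
    · rw [Polynomial.notMem_support_iff.1 hj, map_zero, zero_mul, map_zero]
    · rw [map_mul, Polynomial.aeval_C, Algebra.smul_def, ← hq, eq_intCast, ← zsmul_eq_mul,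
        ← zsmul_eq_mul, map_zsmul]
  · simp

/-! ### The 5-adic induction -/

/-- The divisibility satisfied by the coefficients along `5 ^ (2 * α - 1)`. -/
def OddDivisible (α : ℕ) (f : Polynomial ℤ) : Prop :=
  ∀ j, (j < 2 → f.coeff j = 0) ∧ (5 : ℤ) ^ (α + (5 * j - 10) / 2) ∣ f.coeff j

/-- The divisibility satisfied by the coefficients along `5 ^ (2 * α)`. -/
def EvenDivisible (α : ℕ) (f : Polynomial ℤ) : Prop :=
  ∀ i, (i < 1 → f.coeff i = 0) ∧ (5 : ℤ) ^ (α + 1 + (5 * i - 5) / 2) ∣ f.coeff i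

theorem OddDivisible.exists_evenDivisible {α : ℕ} {f : Polynomial ℤ} (hf : OddDivisible α f) :
    ∃ g, quinsect 0 (Polynomial.aeval tauSeries f) = Polynomial.aeval tauSeries g ∧
      EvenDivisible α g := by
  have hq := fun j => exists_aeval_eq_of_mul_pow (quinsect_tauSeries_pow_mul j)
    fun i hi => coeff_sectionPoly_eq_zero (by omega)
  choose q hq hqc using hq
  obtain ⟨g, hg, hgc⟩ := exists_sum_aeval_eq (quinsect 0) hq f
  refine ⟨g, hg, fun i => ⟨fun hi => ?_, ?_⟩⟩
  · rw [hgc]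
    refine Finset.sum_eq_zero fun j _ => ?_
    rcases lt_or_ge j 2 with hj | hj
    · rw [(hf j).1 hj, zero_mul]
    · rw [hqc, coeff_sectionPoly_eq_zero (by omega), mul_zero]
  · rw [hgc]
    refine Finset.dvd_sum fun j _ => ?_
    rcases lt_or_ge j 2 with hj | hj
    · rw [(hf j).1 hj, zero_mul]
      exact dvd_zero ((5 : ℤ) ^ _)
    · rcases Nat.eq_zero_or_pos i with rfl | hi
      · rw [hqc, coeff_sectionPoly_eq_zero (by omega)]
        exact dvd_mul_of_dvd_right (dvd_zero _) _
      · rw [hqc]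
        -- The coefficient of τ^i in U(τ^j) has valuation at least (5i - j - 1)/2. The estimate is
        -- tight at j = 2, where (5i - 3)/2 = 1 + (5i - 5)/2 provides the new factor 5; for larger j
        -- the growth of (5j - 10)/2 prevails.
        refine pow_dvd_mul_of_le (hf j).2 (pow_dvd_coeff_sectionPoly _ _) ?_
        rcases hj.eq_or_lt with rfl | hj <;> omega

theorem EvenDivisible.exists_oddDivisible {α : ℕ} {g : Polynomial ℤ} (hg : EvenDivisible α g) :
    ∃ f, expandFive eulerSeries ^ 7 *
        quinsect 0 (X ^ 7 * partitionSeries ^ 7 * Polynomial.aeval tauSeries g) =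
        Polynomial.aeval tauSeries f ∧ OddDivisible (α + 1) f := by
  have hq := fun j => exists_aeval_eq_of_mul_pow (quinsect_partitionSeries_pow_mul j)
    fun i hi => coeff_sectionPoly_eq_zero (by omega)
  choose q hq hqc using hq
  obtain ⟨f, hf, hfc⟩ := exists_sum_aeval_eq
    ((AddMonoidHom.mulLeft (expandFive eulerSeries ^ 7)).comp
      ((quinsect 0).comp (AddMonoidHom.mulLeft (X ^ 7 * partitionSeries ^ 7)))) hq g
  refine ⟨f, hf, fun j => ⟨fun hj => ?_, ?_⟩⟩
  · rw [hfc]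
    refine Finset.sum_eq_zero fun i _ => ?_
    rw [hqc, coeff_sectionPoly_eq_zero (by omega), mul_zero]
  · rw [hfc]
    refine Finset.dvd_sum fun i _ => ?_
    rcases Nat.eq_zero_or_pos i with rfl | hi
    · rw [(hg 0).1 one_pos, zero_mul]
      exact dvd_zero ((5 : ℤ) ^ _)
    · rw [hqc]
      -- Here the operator contributes (5j - i - 8)/2; the worst case i = 1 gives (5j - 9)/2, enough
      -- for (5j - 10)/2 after rounding down.
      exact pow_dvd_mul_of_le (hg i).2 (pow_dvd_coeff_sectionPoly _ _) (by omega)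

theorem oddDivisible_one : OddDivisible 1 (sectionPoly 11) := fun j =>
  ⟨fun hj => coeff_sectionPoly_eq_zero (by omega), by
    rcases lt_or_ge j 2 with hj | hj
    · rw [coeff_sectionPoly_eq_zero (by omega)]
      exact dvd_zero ((5 : ℤ) ^ _)
    · exact (pow_dvd_pow 5 (by omega)).trans (pow_dvd_coeff_sectionPoly 11 j)⟩

/-- The series of the `7`-colored partition counts at
`5 ^ (2 * b + 1) * n + (13 * 5 ^ (2 * b + 1) + 7) / 24`. -/
noncomputable def oddSection : ℕ → ℤ⟦X⟧
  | 0 => quinsect 3 (partitionSeries ^ 7)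
  | b + 1 => quinsect 2 (quinsect 3 (oddSection b))

theorem exists_oddDivisible_oddSection (b : ℕ) :
    ∃ f, X ^ 2 * expandFive eulerSeries ^ 7 * oddSection b = Polynomial.aeval tauSeries f ∧
      OddDivisible (b + 1) f := by
  induction b with
  | zero =>
    refine ⟨sectionPoly 11, ?_, oddDivisible_one⟩
    have h := quinsect_partitionSeries_pow_mul 0
    rw [pow_zero, mul_one, mul_one, quinsect_X_pow_mul (r := 3) (m := 2) (by norm_num) rfl] at h
    rw [← h, oddSection]
    ring
  | succ b ih =>
    obtain ⟨f, hf, hfd⟩ := ih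
    obtain ⟨g, hg, hgd⟩ := hfd.exists_evenDivisible
    obtain ⟨f', hf', hfd'⟩ := hgd.exists_oddDivisible
    refine ⟨f', ?_, hfd'⟩
    have h1 : Polynomial.aeval tauSeries g = X * eulerSeries ^ 7 * quinsect 3 (oddSection b) := by
      rw [← hg, ← hf, show X ^ 2 * expandFive eulerSeries ^ 7 * oddSection b =
        expandFive (eulerSeries ^ 7) * (X ^ 2 * oddSection b) by rw [map_pow]; ring,
        quinsect_expandFive_mul (by norm_num),
        quinsect_X_pow_mul (r := 3) (m := 1) (by norm_num) rfl]
      ring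
    have h2 : X ^ 7 * partitionSeries ^ 7 * (X * eulerSeries ^ 7 * quinsect 3 (oddSection b)) =
        X ^ 8 * quinsect 3 (oddSection b) := by
      calc _ = X ^ 8 * (eulerSeries * partitionSeries) ^ 7 * quinsect 3 (oddSection b) := by ring
        _ = _ := by rw [eulerSeries_mul_partitionSeries, one_pow, mul_one]
    -- The residues alternate because q^2 in front of the odd stage selects 3 = 5 - 2, while q^8 = q
    -- · q^7 selects 2 = 10 - 8.
    rw [← hf', h1, h2, quinsect_X_pow_mul (r := 2) (m := 2) (by norm_num) rfl, oddSection]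
    ring

theorem exists_evenDivisible_quinsect_oddSection (b : ℕ) :
    ∃ g, X * eulerSeries ^ 7 * quinsect 3 (oddSection b) = Polynomial.aeval tauSeries g ∧
      EvenDivisible (b + 1) g := by
  obtain ⟨f, hf, hfd⟩ := exists_oddDivisible_oddSection b
  obtain ⟨g, hg, hgd⟩ := hfd.exists_evenDivisible
  refine ⟨g, ?_, hgd⟩
  rw [← hg, ← hf, show X ^ 2 * expandFive eulerSeries ^ 7 * oddSection b =
    expandFive (eulerSeries ^ 7) * (X ^ 2 * oddSection b) by rw [map_pow]; ring,
    quinsect_expandFive_mul (by norm_num),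
    quinsect_X_pow_mul (r := 3) (m := 1) (by norm_num) rfl]
  ring

/-! ### The extra factor 5 in the residue classes 2 and 4 -/

/-- By Frobenius E(q^5) ≡ E^5 modulo 5; three of the five factors E(q^5) absorb P^12 and leave E^3.
-/
theorem expandFive_eulerSeries_pow_mul_partitionSeries_pow :
    (5 : ℤ⟦X⟧) ∣ expandFive eulerSeries ^ 5 * partitionSeries ^ 12 -
      eulerSeries ^ 3 * expandFive eulerSeries ^ 2 := by
  have h1 := eulerSeries_mul_partitionSeries
  have h : (5 : ℤ⟦X⟧) ∣ expandFive eulerSeries - eulerSeries ^ 5 := by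
    have : Fact (Nat.Prime 5) := ⟨by norm_num⟩
    have hz : PowerSeries.map (Int.castRingHom (ZMod 5)) (expandFive eulerSeries - eulerSeries ^ 5)
        = 0 := by
      rw [map_sub, map_pow, map_expand, map_pentagonalSeries]
      have h : PowerSeries.map (frobenius (ZMod 5) 5) (expand 5 (by norm_num)
          (pentagonalSeries (ZMod 5))) = pentagonalSeries (ZMod 5) ^ 5 :=
        MvPowerSeries.map_frobenius_expand 5 (by norm_num)
      rw [← h, map_expand, map_pentagonalSeries, sub_self]
    have hd : ∀ n, (5 : ℤ) ∣ coeff n (expandFive eulerSeries - eulerSeries ^ 5) := by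
      intro n
      have h := congrArg (coeff n) hz
      rw [coeff_map, map_zero, eq_intCast, ZMod.intCast_zmod_eq_zero_iff_dvd] at h
      exact_mod_cast h
    choose c hc using hd
    refine ⟨PowerSeries.mk c, ?_⟩
    ext n
    rw [hc, show (5 : ℤ⟦X⟧) = C 5 by simp, coeff_C_mul, coeff_mk]
  have h3 : expandFive eulerSeries ^ 5 * partitionSeries ^ 12 -
      eulerSeries ^ 3 * expandFive eulerSeries ^ 2 =
      expandFive eulerSeries ^ 2 * partitionSeries ^ 12 *
        (expandFive eulerSeries ^ 3 - (eulerSeries ^ 5) ^ 3) := by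
    calc _ = expandFive eulerSeries ^ 5 * partitionSeries ^ 12 -
        eulerSeries ^ 3 * expandFive eulerSeries ^ 2 * (eulerSeries * partitionSeries) ^ 12 := by
          rw [h1]; ring
      _ = _ := by ring
  rw [h3]
  exact dvd_mul_of_dvd_right (h.trans (sub_dvd_pow_sub_pow _ _ 3)) _

theorem pow_dvd_coeff_of_dvd_mul {k m : ℕ} {V W L : ℤ⟦X⟧} (hVW : V * W = 1)
    (h : (5 : ℤ⟦X⟧) ^ k ∣ X ^ m * V * L) (n : ℕ) : (5 : ℤ) ^ k ∣ coeff n L := by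
  obtain ⟨G, hG⟩ := h
  have h1 : X ^ m * L = C ((5 : ℤ) ^ k) * (G * W) := by
    calc X ^ m * L = X ^ m * V * L * W := by rw [mul_right_comm, mul_assoc (X ^ m), hVW, mul_one]
      _ = _ := by rw [hG, map_pow]; simp only [map_ofNat]; ring
  have h2 := congrArg (coeff (n + m)) h1
  rw [coeff_X_pow_mul, coeff_C_mul] at h2
  exact ⟨_, h2⟩

theorem pow_dvd_aeval {k : ℕ} {f : Polynomial ℤ} (h : ∀ j, (5 : ℤ) ^ k ∣ f.coeff j) (S : ℤ⟦X⟧) :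
    (5 : ℤ⟦X⟧) ^ k ∣ Polynomial.aeval S f := by
  obtain ⟨g, rfl⟩ := (Polynomial.C_dvd_iff_dvd_coeff _ _).2 h
  rw [map_mul, Polynomial.aeval_C, eq_intCast]
  push_cast
  exact dvd_mul_right _ _

theorem pow_dvd_coeff_oddSection (b n : ℕ) : (5 : ℤ) ^ (b + 1) ∣ coeff n (oddSection b) := by
  obtain ⟨f, hf, hfd⟩ := exists_oddDivisible_oddSection b
  refine pow_dvd_coeff_of_dvd_mul (m := 2) (V := expandFive eulerSeries ^ 7)
    (W := expandFive partitionSeries ^ 7) ?_ ?_ n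
  · rw [← mul_pow, expandFive_eulerSeries_mul_partitionSeries, one_pow]
  · rw [hf]
    exact pow_dvd_aeval (fun j => (pow_dvd_pow 5 (Nat.le_add_right _ _)).trans (hfd j).2) _

theorem pow_dvd_coeff_quinsect_three_oddSection (b n : ℕ) :
    (5 : ℤ) ^ (b + 2) ∣ coeff n (quinsect 3 (oddSection b)) := by
  obtain ⟨g, hg, hgd⟩ := exists_evenDivisible_quinsect_oddSection b
  refine pow_dvd_coeff_of_dvd_mul (m := 1) (V := eulerSeries ^ 7)
    (W := partitionSeries ^ 7) ?_ ?_ n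
  · rw [← mul_pow, eulerSeries_mul_partitionSeries, one_pow]
  · rw [pow_one, hg]
    exact pow_dvd_aeval (fun j => (pow_dvd_pow 5 (Nat.le_add_right _ _)).trans (hgd j).2) _

/-- Modulo 5^(b+2) only the τ^2 term matters, since the coefficients of τ^j with j ≥ 3 are divisible
by 5^(b+3). Its own coefficient carries 5^(b+1), so the accompanying series is needed only modulo 5,
where it is E^3 E(q^5)^2 up to the unit normalization. -/
theorem pow_dvd_coeff_oddSection_of_cube {r : ℕ} (hr : r < 5)
    (hE : quinsect r (eulerSeries ^ 3) = 0) (b n : ℕ) :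
    (5 : ℤ) ^ (b + 2) ∣ coeff (5 * n + r) (oddSection b) := by
  obtain ⟨f, hf, hfd⟩ := exists_oddDivisible_oddSection b
  have h2 := expandFive_eulerSeries_mul_partitionSeries
  have hrest : (5 : ℤ⟦X⟧) ^ (b + 2) ∣ Polynomial.aeval tauSeries
      (f - Polynomial.C (f.coeff 2) * Polynomial.X ^ 2) := by
    refine pow_dvd_aeval (fun j => ?_) _
    rw [Polynomial.coeff_sub, Polynomial.coeff_C_mul, Polynomial.coeff_X_pow]
    rcases lt_trichotomy j 2 with hj | rfl | hj
    · rw [(hfd j).1 hj, if_neg hj.ne, mul_zero, sub_zero]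
      exact dvd_zero _
    · simp
    · rw [if_neg hj.ne', mul_zero, sub_zero]
      exact (pow_dvd_pow 5 (by omega)).trans (hfd j).2
  have hc : (5 : ℤ⟦X⟧) ^ (b + 1) ∣ (f.coeff 2 : ℤ⟦X⟧) := by
    obtain ⟨c, hc⟩ := (hfd 2).2
    rw [hc]
    push_cast
    exact dvd_mul_right _ _
  have hdiff : (5 : ℤ⟦X⟧) ^ (b + 2) ∣ X ^ 2 * expandFive eulerSeries ^ 7 *
      (oddSection b - (f.coeff 2 : ℤ⟦X⟧) * (eulerSeries ^ 3 * expandFive eulerSeries ^ 2)) := by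
    have hs := mul_dvd_mul hc expandFive_eulerSeries_pow_mul_partitionSeries_pow
    rw [← pow_succ] at hs
    have key : X ^ 2 * expandFive eulerSeries ^ 7 *
        (oddSection b - (f.coeff 2 : ℤ⟦X⟧) * (eulerSeries ^ 3 * expandFive eulerSeries ^ 2)) =
        Polynomial.aeval tauSeries (f - Polynomial.C (f.coeff 2) * Polynomial.X ^ 2) +
        X ^ 2 * expandFive eulerSeries ^ 7 * ((f.coeff 2 : ℤ⟦X⟧) *
          (expandFive eulerSeries ^ 5 * partitionSeries ^ 12 -
            eulerSeries ^ 3 * expandFive eulerSeries ^ 2)) := by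
      rw [map_sub, ← hf, map_mul, Polynomial.aeval_C, eq_intCast, map_pow, Polynomial.aeval_X,
        tauSeries]
      ring
    rw [key]
    exact dvd_add hrest (dvd_mul_of_dvd_right hs _)
  have hV : expandFive eulerSeries ^ 7 * expandFive partitionSeries ^ 7 = 1 := by
    rw [← mul_pow, h2, one_pow]
  have h3 := pow_dvd_coeff_of_dvd_mul hV hdiff (5 * n + r)
  have h4 : coeff (5 * n + r)
      ((f.coeff 2 : ℤ⟦X⟧) * (eulerSeries ^ 3 * expandFive eulerSeries ^ 2)) = 0 := by
    rw [← coeff_quinsect, show (f.coeff 2 : ℤ⟦X⟧) * (eulerSeries ^ 3 * expandFive eulerSeries ^ 2) =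
      expandFive ((f.coeff 2 : ℤ⟦X⟧) * eulerSeries ^ 2) * eulerSeries ^ 3 by
        rw [map_mul, map_intCast, map_pow]; ring,
      quinsect_expandFive_mul hr, hE, mul_zero, map_zero]
  rwa [map_sub, h4, sub_zero] at h3

/-! ### Translation to partition counts -/

theorem coeff_oddSection (b n : ℕ) :
    coeff n (oddSection b) = coloredPartitionCount 7
      (5 ^ (2 * b + 1) * n + (13 * 5 ^ (2 * b + 1) + 7) / 24) := by
  induction b generalizing n with
  | zero => rw [oddSection, coeff_quinsect, coloredPartitionCount_eq_coeff]; norm_num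
  | succ b ih =>
    rw [oddSection, coeff_quinsect, coeff_quinsect, ih]
    -- Exactness of the division by 24 is needed: the two sections add 13 · 5^(2b+1) to the offset,
    -- and (13x + 7)/24 + 13x = (25 · 13x + 7)/24 for x = 5^(2b+1).
    have h := (twentyFour_dvd (b + 1) (by omega)).1
    rw [show 2 * (b + 1) - 1 = 2 * b + 1 by omega] at h
    have h1 : 5 ^ (2 * (b + 1) + 1) = 25 * 5 ^ (2 * b + 1) := by ring
    rw [h1, show 5 ^ (2 * b + 1) * (5 * (5 * n + 2) + 3) =
      25 * (5 ^ (2 * b + 1) * n) + 13 * 5 ^ (2 * b + 1) by ring, mul_assoc 25]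
    congr 2
    omega

/-- The class r modulo 5 turns the constant 13 into 13 + 24r: 61 for r = 2, 109 for r = 4, and 85 =
5 · 17 for r = 3. -/
theorem coloredPartitionCount_modEq_zero {r k : ℕ}
    (hr : ∀ b n, (5 : ℤ) ^ (b + k) ∣ coeff (5 * n + r) (oddSection b))
    (b n : ℕ) :
    coloredPartitionCount 7 (5 ^ (2 * b + 2) * n + ((13 + 24 * r) * 5 ^ (2 * b + 1) + 7) / 24)
      ≡ 0 [MOD 5 ^ (b + k)] := by
  have h := hr b n
  rw [coeff_oddSection] at h
  have h24 := (twentyFour_dvd (b + 1) (by omega)).1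
  rw [show 2 * (b + 1) - 1 = 2 * b + 1 by omega] at h24
  rw [Nat.modEq_zero_iff_dvd, show 5 ^ (2 * b + 2) * n + ((13 + 24 * r) * 5 ^ (2 * b + 1) + 7) / 24 =
    5 ^ (2 * b + 1) * (5 * n + r) + (13 * 5 ^ (2 * b + 1) + 7) / 24 by
      rw [show (13 + 24 * r) * 5 ^ (2 * b + 1) = 13 * 5 ^ (2 * b + 1) + 24 * (5 ^ (2 * b + 1) * r) by
        ring, show 5 ^ (2 * b + 2) * n = 5 * (5 ^ (2 * b + 1) * n) by ring,
        show 5 ^ (2 * b + 1) * (5 * n + r) = 5 * (5 ^ (2 * b + 1) * n) + 5 ^ (2 * b + 1) * r by ring]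
      omega]
  exact_mod_cast h

theorem theorem1p4 (n α : ℕ) (hα : 1 ≤ α) :
    coloredPartitionCount 7 (5 ^ (2 * α - 1) * n + (13 * 5 ^ (2 * α - 1) + 7) / 24)
        ≡ 0 [MOD 5 ^ α] ∧
    coloredPartitionCount 7 (5 ^ (2 * α) * n + (17 * 5 ^ (2 * α) + 7) / 24)
        ≡ 0 [MOD 5 ^ (α + 1)] ∧
    coloredPartitionCount 7 (5 ^ (2 * α) * n + (61 * 5 ^ (2 * α - 1) + 7) / 24)
        ≡ 0 [MOD 5 ^ (α + 1)] ∧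
    coloredPartitionCount 7 (5 ^ (2 * α) * n + (109 * 5 ^ (2 * α - 1) + 7) / 24)
        ≡ 0 [MOD 5 ^ (α + 1)] := by
  obtain ⟨b, rfl⟩ : ∃ b, α = b + 1 := ⟨α - 1, by omega⟩
  rw [show 2 * (b + 1) - 1 = 2 * b + 1 by omega, show 2 * (b + 1) = 2 * b + 2 by ring]
  refine ⟨?_, ?_, ?_, ?_⟩
  · rw [Nat.modEq_zero_iff_dvd]
    have h := pow_dvd_coeff_oddSection b n
    rw [coeff_oddSection] at h
    exact_mod_cast h
  · have h := coloredPartitionCount_modEq_zero (r := 3) (k := 2)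
      (fun b n => by simpa using pow_dvd_coeff_quinsect_three_oddSection b n) b n
    rwa [show (13 + 24 * 3) * 5 ^ (2 * b + 1) = 17 * 5 ^ (2 * b + 2) by ring] at h
  · exact coloredPartitionCount_modEq_zero (r := 2) (k := 2)
      (pow_dvd_coeff_oddSection_of_cube (by norm_num) quinsect_eulerSeries_cube.1) b n
  · exact coloredPartitionCount_modEq_zero (r := 4) (k := 2)
      (pow_dvd_coeff_oddSection_of_cube (by norm_num) quinsect_eulerSeries_cube.2.2) b n
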